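/- Let $\Delta^+=\{z\in\mathbb C : |z|<1,\ \operatorname{Im} z>0\}$ and, for $C>0$, let $\Gamma_C=\{z\in\mathbb C : |\operatorname{Im} z|\le C|\operatorname{Re} z|\}$. Let $C>0$ and let $f:\Delta^+\cup(-1,1)\to\mathbb C$ be holomorphic on $\Delta^+$ and $\mathcal C^\infty$-smooth up to $(-1,1)$ (that is, $\mathcal C^\infty$ in the real sense on $\Delta^+\cup(-1,1)$), with $f(x)\in\Gamma_C$ for every $x\in(-1,1)$. Suppose that the zeros of $f|_{(-1,1)}$ have no accumulation point in $(-1,1)$ other than possibly $0$. If $f$ vanishes to infinite order at $0$, i.e. $$\lim_{\Delta^+\ni z\to 0}\frac{f(z)}{|z|^N}=0\qquad\text{for every } N\in\mathbb N,$$ then $f\equiv 0$ on $\Delta^+\cup(-1,1)$. -/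

import Mathlib

open Set Filter Topology
open scoped ContDiff

/-- The upper half disc `Δ⁺ = {z : |z| < 1, Im z > 0}`. -/
def upperHalfDisc : Set ℂ := {z | ‖z‖ < 1 ∧ 0 < z.im}

/-- The open interval `(-1, 1)`, as a subset of `ℂ` (the open diameter of the half disc). -/
def openDiameter : Set ℂ := (fun x : ℝ => (x : ℂ)) '' Ioo (-1 : ℝ) 1

/-- The cone `Γ_C = {z : |Im z| ≤ C |Re z|}`. -/
def coneGamma (C : ℝ) : Set ℂ := {z | |z.im| ≤ C * |z.re|}

/-- `f` vanishes to infinite order at the boundary point `a` of `Ω`: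
for every `N`, `f z / |z - a| ^ N → 0` as `z → a` with `z ∈ Ω`. -/
def VanishesToInfiniteOrder (f : ℂ → ℂ) (Ω : Set ℂ) (a : ℂ) : Prop :=
  ∀ N : ℕ, Tendsto (fun z => f z / ((‖z - a‖ ^ N : ℝ) : ℂ)) (𝓝[Ω] a) (𝓝 0)

/-- The set of zeros of `f` on `(-1, 1)`. -/
def diameterZeros (f : ℂ → ℂ) : Set ℂ := {z | z ∈ openDiameter ∧ f z = 0}

/-!
The idea is to divide out the argument of `f` on the diameter. On `(-1, 1)` the cone condition gives
`f(x) = ± |f(x)| e^{iθ(x)}` with `θ = arctan (Im f / Re f)`, and `|θ| ≤ arctan C < π / 2`. Let `L` be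
the Cauchy transform of `θ`, a holomorphic function on the upper half plane whose imaginary part is
minus the Poisson extension of `θ`. Then `f e^L` has real boundary values on the diameter, in a weak
sense: `Im ∫ f(x) e^{L(x + iε)} (r² - x²)² x^m dx → 0` as `ε → 0`, for every integer `m`. The
integrand makes sense for negative `m` too, because `f` vanishes to infinite order at `0`. The
pointwise convergence is clear, as every `x` is either a zero of `f` or a point of continuity of
`θ`. The passage to the limit (`tendsto_integral_im_mul_exp`) needs uniform integrability of
`e^{L(x + iε)}`, and this is where `arctan C < π / 2` enters: for some `p > 1` the power `e^{pL}`
still takes values in a sector strictly inside the right half plane, which bounds its `L^1` norm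
(`integral_norm_exp_mul_weight_le`).

Cauchy's theorem on the half disc of radius `r` carries these integrals to the arc
(`re_integral_arc_eq_zero`): the function `a(φ) = f e^L (r² - z²)²` at `z = r e^{iφ}` satisfies
`Re ∫_0^π a(φ) e^{inφ} dφ = 0` for all `n ∈ ℤ`. The weight `(r² - z²)²` makes `a` continuous and zero
at both ends of the arc. Since positive and negative `n` are both available, the function
`a(φ) + conj (a(-φ))` on the circle has only zero Fourier coefficients
(`eq_zero_of_re_integral_mul_exp_eq_zero`). So `a = 0`, and `f` vanishes on every arc `|z| = r < 1`.
-/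

/-! ### Cauchy's theorem on a half disc -/

/-- The substitution `t = exp x` on a compact subinterval of `(0, ∞)`. -/
theorem integral_exp_smul_comp_exp {G : ℝ → ℂ} {s r : ℝ} (hs : 0 < s) (hsr : s ≤ r)
    (hG : ContinuousOn G (Icc s r)) :
    ∫ x in Real.log s..Real.log r, Real.exp x • G (Real.exp x) = ∫ x in s..r, G x := by
  have hr := hs.trans_le hsr
  have himg : Real.exp '' uIcc (Real.log s) (Real.log r) ⊆ Icc s r := by
    rw [uIcc_of_le (Real.log_le_log hs hsr)]
    rintro _ ⟨x, hx, rfl⟩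
    exact ⟨(Real.log_le_iff_le_exp hs).1 hx.1, (Real.le_log_iff_exp_le hr).1 hx.2⟩
  have := intervalIntegral.integral_deriv_smul_comp'' (a := Real.log s) (b := Real.log r)
    (f := Real.exp) (f' := Real.exp) (g := G) Real.continuous_exp.continuousOn
    (fun x _ => (Real.hasDerivAt_exp x).hasDerivWithinAt) Real.continuous_exp.continuousOn
    (hG.mono himg)
  rwa [Real.exp_log hs, Real.exp_log hr] at this

/-- Cauchy's theorem for a half disc. The boundary of a half annulus is the image under `exp` of the
boundary of a rectangle; letting the inner radius tend to `0` gives the half disc. -/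
theorem integral_diameter_add_integral_arc_eq_zero {F : ℂ → ℂ} {r : ℝ} (hr : 0 < r)
    (hc : ContinuousOn F {z | ‖z‖ ≤ r ∧ 0 ≤ z.im})
    (hd : DifferentiableOn ℂ F {z | ‖z‖ < r ∧ 0 < z.im}) :
    (∫ x in (-r)..r, F x) +
      ∫ φ in (0 : ℝ)..Real.pi, F (r * Complex.exp (φ * Complex.I)) *
        (r * Complex.exp (φ * Complex.I) * Complex.I) = 0 := by
  have hcr : ContinuousOn (fun x : ℝ => F x) (Icc (-r) r) := by
    refine hc.comp Complex.continuous_ofReal.continuousOn fun x hx => ?_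
    simpa [abs_le] using hx
  -- the contour around the half annulus `s ≤ |z| ≤ r`, in logarithmic coordinates
  have key : ∀ s ∈ Ioo 0 r, (∫ x in s..r, F x) + (∫ x in (-r)..(-s), F x) +
      (∫ φ in (0 : ℝ)..Real.pi, F (r * Complex.exp (φ * Complex.I)) *
        (r * Complex.exp (φ * Complex.I) * Complex.I)) =
      ∫ φ in (0 : ℝ)..Real.pi, F (s * Complex.exp (φ * Complex.I)) *
        (s * Complex.exp (φ * Complex.I) * Complex.I) := by
    intro s hs
    have hlog : Real.log s < Real.log r := Real.log_lt_log hs.1 hs.2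
    have hpi := Real.pi_pos
    have hnorm : ∀ w : ℂ, ‖Complex.exp w‖ = Real.exp w.re := Complex.norm_exp
    have him : ∀ w : ℂ, (Complex.exp w).im = Real.exp w.re * Real.sin w.im := Complex.exp_im
    have h := Complex.integral_boundary_rect_eq_zero_of_continuousOn_of_differentiableOn
      (fun w => F (Complex.exp w) * Complex.exp w) ⟨Real.log s, 0⟩ ⟨Real.log r, Real.pi⟩
      (by
        refine ContinuousOn.mul (hc.comp Complex.continuous_exp.continuousOn ?_)
          Complex.continuous_exp.continuousOn
        rintro w ⟨h1, h2⟩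
        simp only [uIcc_of_le hlog.le, uIcc_of_le hpi.le, mem_preimage, mem_Icc] at h1 h2
        refine ⟨?_, ?_⟩
        · rw [hnorm]; exact (Real.exp_le_exp.2 h1.2).trans (Real.exp_log hr).le
        · rw [him]
          exact mul_nonneg (Real.exp_pos _).le (Real.sin_nonneg_of_nonneg_of_le_pi h2.1 h2.2))
      (by
        refine DifferentiableOn.mul (hd.comp Complex.differentiable_exp.differentiableOn ?_)
          Complex.differentiable_exp.differentiableOn
        rintro w ⟨h1, h2⟩
        simp only [min_eq_left hlog.le, min_eq_left hpi.le, max_eq_right hlog.le,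
          max_eq_right hpi.le, mem_preimage, mem_Ioo] at h1 h2
        refine ⟨?_, ?_⟩
        · rw [hnorm]; exact (Real.exp_lt_exp.2 h1.2).trans_le (Real.exp_log hr).le
        · rw [him]
          exact mul_pos (Real.exp_pos _) (Real.sin_pos_of_pos_of_lt_pi h2.1 h2.2))
    have e1 : (∫ x in Real.log s..Real.log r, F (Complex.exp ((x : ℝ) + ((0 : ℝ) : ℂ) * Complex.I))
        * Complex.exp ((x : ℝ) + ((0 : ℝ) : ℂ) * Complex.I)) = ∫ x in s..r, F x := by
      rw [← integral_exp_smul_comp_exp (G := fun x => F x) hs.1 hs.2.le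
        (hcr.mono (Icc_subset_Icc (by linarith [hs.1]) le_rfl))]
      congr 1; ext x
      simp [mul_comm]
    have e2 : (∫ x in Real.log s..Real.log r, F (Complex.exp ((x : ℝ) + (Real.pi : ℂ) * Complex.I))
        * Complex.exp ((x : ℝ) + (Real.pi : ℂ) * Complex.I)) = -∫ x in (-r)..(-s), F x := by
      rw [← intervalIntegral.integral_comp_neg (fun x : ℝ => F x),
        ← integral_exp_smul_comp_exp (G := fun x : ℝ => F ((-x : ℝ))) hs.1 hs.2.le,
        ← intervalIntegral.integral_neg]
      · congr 1; ext x
        rw [Complex.exp_add, Complex.exp_pi_mul_I, ← Complex.ofReal_exp]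
        simp [mul_comm]
      · refine hcr.comp (f := fun x : ℝ => -x) continuous_neg.continuousOn fun x hx => ?_
        exact ⟨by linarith [hx.2], by linarith [hx.1, hs.1]⟩
    have e3 : ∀ q : ℝ, 0 < q →
        Complex.I • (∫ φ in (0 : ℝ)..Real.pi, F (Complex.exp ((Real.log q : ℝ) + (φ : ℂ) * Complex.I))
        * Complex.exp ((Real.log q : ℝ) + (φ : ℂ) * Complex.I)) =
        ∫ φ in (0 : ℝ)..Real.pi, F (q * Complex.exp (φ * Complex.I)) *
        (q * Complex.exp (φ * Complex.I) * Complex.I) := by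
      intro q hq
      rw [smul_eq_mul, ← intervalIntegral.integral_const_mul]
      congr 1; ext φ
      rw [Complex.exp_add, ← Complex.ofReal_exp, Real.exp_log hq]
      ring
    simp only at h
    rw [e1, e2, e3 r hr, e3 s hs.1] at h
    linear_combination h
  obtain ⟨B, hB⟩ : ∃ B, ∀ z ∈ {z : ℂ | ‖z‖ ≤ r ∧ 0 ≤ z.im}, ‖F z‖ ≤ B := by
    refine IsCompact.exists_bound_of_continuousOn ?_ hc
    have : {z : ℂ | ‖z‖ ≤ r ∧ 0 ≤ z.im} = Metric.closedBall 0 r ∩ {z : ℂ | 0 ≤ z.im} := by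
      ext; simp
    rw [this]
    exact (isCompact_closedBall _ _).inter_right (isClosed_le continuous_const Complex.continuous_im)
  set A := ∫ φ in (0 : ℝ)..Real.pi, F (r * Complex.exp (φ * Complex.I)) *
        (r * Complex.exp (φ * Complex.I) * Complex.I)
  have hle : ∀ s ∈ Ioo 0 r, ‖(∫ x in (-r)..r, F x) + A‖ ≤ (2 * B + B * Real.pi) * s := by
    intro s hs
    have hint : ∀ a ∈ Icc (-r) r, ∀ b ∈ Icc (-r) r,
        IntervalIntegrable (fun x : ℝ => F x) MeasureTheory.volume a b := fun a ha b hb =>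
      (hcr.mono (uIcc_subset_Icc ha hb)).intervalIntegrable
    have m1 : -r ∈ Icc (-r) r := ⟨le_rfl, by linarith⟩
    have m2 : -s ∈ Icc (-r) r := ⟨by linarith [hs.2], by linarith [hs.1]⟩
    have m3 : s ∈ Icc (-r) r := ⟨by linarith [hs.1], hs.2.le⟩
    have m4 : r ∈ Icc (-r) r := ⟨by linarith, le_rfl⟩
    have hsplit := intervalIntegral.integral_add_adjacent_intervals (hint _ m1 _ m2) (hint _ m2 _ m3)
    have hsplit' := intervalIntegral.integral_add_adjacent_intervals (hint _ m1 _ m3) (hint _ m3 _ m4)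
    have h1 : ‖∫ x in (-s)..s, F x‖ ≤ B * |s - -s| := by
      refine intervalIntegral.norm_integral_le_of_norm_le_const fun x hx => hB _ ?_
      rw [uIoc_of_le (by linarith [hs.1])] at hx
      refine ⟨?_, by simp⟩
      rw [Complex.norm_real, Real.norm_eq_abs, abs_le]
      exact ⟨by linarith [hx.1, hs.2], by linarith [hx.2, hs.2]⟩
    rw [abs_of_pos (by linarith [hs.1])] at h1
    have h2 : ‖∫ φ in (0 : ℝ)..Real.pi, F (s * Complex.exp (φ * Complex.I)) *
        (s * Complex.exp (φ * Complex.I) * Complex.I)‖ ≤ (B * s) * |Real.pi - 0| := by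
      refine intervalIntegral.norm_integral_le_of_norm_le_const fun φ hφ => ?_
      rw [uIoc_of_le Real.pi_pos.le] at hφ
      have : ‖(s : ℂ) * Complex.exp (φ * Complex.I)‖ = s := by
        simp [Complex.norm_exp_ofReal_mul_I, abs_of_pos hs.1]
      rw [norm_mul, norm_mul, this, Complex.norm_I, mul_one]
      refine mul_le_mul_of_nonneg_right (hB _ ⟨this.le.trans hs.2.le, ?_⟩) hs.1.le
      rw [Complex.im_ofReal_mul, Complex.exp_ofReal_mul_I_im]
      exact mul_nonneg hs.1.le (Real.sin_nonneg_of_nonneg_of_le_pi hφ.1.le hφ.2)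
    rw [sub_zero, abs_of_pos Real.pi_pos] at h2
    have : (∫ x in (-r)..r, F x) + A = (∫ x in (-s)..s, F x) +
        ∫ φ in (0 : ℝ)..Real.pi, F (s * Complex.exp (φ * Complex.I)) *
        (s * Complex.exp (φ * Complex.I) * Complex.I) := by
      rw [← key s hs, ← hsplit', ← hsplit]; ring
    rw [this]
    refine (norm_add_le _ _).trans ?_
    linarith
  have hlim : Tendsto (fun s : ℝ => (2 * B + B * Real.pi) * s) (𝓝[>] 0) (𝓝 0) := by
    have : Continuous (fun s : ℝ => (2 * B + B * Real.pi) * s) := by fun_prop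
    simpa using (this.tendsto 0).mono_left nhdsWithin_le_nhds
  rw [← norm_le_zero_iff]
  exact ge_of_tendsto hlim (eventually_of_mem (Ioo_mem_nhdsGT hr) hle)

/-! ### The Cauchy transform of a bounded density -/

/-- The Cauchy transform `z ↦ (1/π) ∫ θ(t) / (z - t) dt` of a density `θ` on the real line, used on
the upper half plane. With this sign and normalisation its imaginary part is minus the Poisson
extension of `θ`. -/
noncomputable def cauchyTransform (θ : ℝ → ℝ) (z : ℂ) : ℂ :=
  (1 / Real.pi : ℝ) * ∫ t : ℝ, (θ t : ℂ) / (z - t)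

section CauchyTransform

variable {θ : ℝ → ℝ} {α : ℝ}

theorem integrable_of_bounded_of_support (hm : Measurable θ) (hb : ∀ t, |θ t| ≤ α)
    (hs : ∀ t ∉ Ioo (-1 : ℝ) 1, θ t = 0) : MeasureTheory.Integrable θ := by
  have : MeasureTheory.IntegrableOn θ (Ioo (-1) 1) :=
    MeasureTheory.Measure.integrableOn_of_bounded (M := α) (by simp) hm.aestronglyMeasurable
      (MeasureTheory.ae_of_all _ hb)
  exact (MeasureTheory.integrableOn_iff_integrable_of_support_subset
    (Function.support_subset_iff'.2 hs)).1 this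

theorem im_le_norm_sub_ofReal (z : ℂ) (t : ℝ) : z.im ≤ ‖z - t‖ := by
  have := (le_abs_self _).trans (Complex.abs_im_le_norm (z - t))
  simpa using this

theorem sub_ofReal_ne_zero {z : ℂ} (hz : 0 < z.im) (t : ℝ) : z - t ≠ 0 :=
  norm_pos_iff.1 (hz.trans_le (im_le_norm_sub_ofReal z t))

theorem integrable_div_sub (hm : Measurable θ) (hi : MeasureTheory.Integrable θ) {z : ℂ}
    (hz : 0 < z.im) : MeasureTheory.Integrable fun t : ℝ => (θ t : ℂ) / (z - t) := by
  refine (hi.norm.mul_const (1 / z.im)).mono' (Measurable.aestronglyMeasurable (by fun_prop))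
    (MeasureTheory.ae_of_all _ fun t => ?_)
  rw [norm_div, Complex.norm_real, div_eq_mul_one_div]
  gcongr
  exact im_le_norm_sub_ofReal z t

theorem differentiableOn_cauchyTransform (hm : Measurable θ) (hi : MeasureTheory.Integrable θ) :
    DifferentiableOn ℂ (cauchyTransform θ) {z | 0 < z.im} := by
  intro z (hz : 0 < z.im)
  refine DifferentiableAt.differentiableWithinAt ?_
  have hev : {w : ℂ | z.im / 2 < w.im} ∈ 𝓝 z :=
    (isOpen_lt continuous_const Complex.continuous_im).mem_nhds (by simpa using hz)
  refine DifferentiableAt.const_mul ?_ _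
  refine (hasDerivAt_integral_of_dominated_loc_of_deriv_le
    (F := fun (w : ℂ) (t : ℝ) => (θ t : ℂ) / (w - t)) (x₀ := z)
    (F' := fun (w : ℂ) (t : ℝ) => -(θ t : ℂ) / (w - t) ^ 2)
    (bound := fun t => ‖θ t‖ * (1 / (z.im / 2) ^ 2)) hev
    (Eventually.of_forall fun w => Measurable.aestronglyMeasurable (by fun_prop))
    (integrable_div_sub hm hi hz) (Measurable.aestronglyMeasurable (by fun_prop))
    (MeasureTheory.ae_of_all _ fun t w hw => ?_) (hi.norm.mul_const _)
    (MeasureTheory.ae_of_all _ fun t w hw => ?_)).2.differentiableAt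
  · rw [norm_div, norm_neg, Complex.norm_real, norm_pow, div_eq_mul_one_div]
    gcongr
    exact (le_of_lt hw).trans (im_le_norm_sub_ofReal w t)
  · have hw0 : w - t ≠ 0 := sub_ofReal_ne_zero ((half_pos hz).trans hw) t
    have := (((hasDerivAt_id w).sub_const (t : ℂ)).inv hw0).const_mul (θ t : ℂ)
    convert! this using 1
    simp only [id]
    ring

/-- The Poisson formula, written after the substitution `t = x + y s`, which moves the dependence
on `y` from the kernel to `θ`. -/
theorem cauchyTransform_im (hm : Measurable θ) (hi : MeasureTheory.Integrable θ) (x : ℝ) {y : ℝ}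
    (hy : 0 < y) : (cauchyTransform θ ⟨x, y⟩).im =
      -((1 / Real.pi) * ∫ s : ℝ, θ (x + y * s) * (1 + s ^ 2)⁻¹) := by
  have hint := integrable_div_sub hm hi (z := ⟨x, y⟩) hy
  have e1 : ∫ s : ℝ, θ (x + y * s) * (1 + s ^ 2)⁻¹ = ∫ t : ℝ, θ t * (y / ((x - t) ^ 2 + y ^ 2)) := by
    have h1 := MeasureTheory.Measure.integral_comp_mul_left
      (fun v => θ (x + v) * (y ^ 2 / (v ^ 2 + y ^ 2))) y
    have h2 := MeasureTheory.integral_add_left_eq_self (μ := MeasureTheory.volume)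
      (fun t => θ t * (y ^ 2 / ((t - x) ^ 2 + y ^ 2))) x
    have h3 : ∀ s : ℝ, (1 + s ^ 2)⁻¹ = y ^ 2 / ((y * s) ^ 2 + y ^ 2) := by
      intro s
      have : 1 + s ^ 2 ≠ 0 := by positivity
      field_simp
      ring
    simp only [add_sub_cancel_left] at h2
    simp only [h3]
    rw [h1, h2, abs_of_pos (inv_pos.2 hy), smul_eq_mul, ← MeasureTheory.integral_const_mul]
    congr 1; ext t
    rw [show (t - x) ^ 2 = (x - t) ^ 2 by ring]
    have : (x - t) ^ 2 + y ^ 2 ≠ 0 := by positivity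
    field_simp
  rw [e1, cauchyTransform, Complex.im_ofReal_mul, ← mul_neg, ← MeasureTheory.integral_neg]
  congr 1
  rw [show (∫ t : ℝ, (θ t : ℂ) / ((⟨x, y⟩ : ℂ) - t)).im =
    ∫ t : ℝ, ((θ t : ℂ) / ((⟨x, y⟩ : ℂ) - t)).im from (integral_im hint).symm]
  congr 1; ext t
  rw [Complex.div_im, Complex.normSq_apply]
  simp
  ring

theorem abs_cauchyTransform_im_le (hm : Measurable θ) (hi : MeasureTheory.Integrable θ)
    (hb : ∀ t, |θ t| ≤ α) {z : ℂ} (hz : 0 < z.im) : |(cauchyTransform θ z).im| ≤ α := by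
  have h := cauchyTransform_im hm hi z.re hz
  rw [Complex.eta] at h
  rw [h, abs_neg, abs_mul, abs_of_pos (by positivity : 0 < 1 / Real.pi)]
  have : ‖∫ s : ℝ, θ (z.re + z.im * s) * (1 + s ^ 2)⁻¹‖ ≤ ∫ s : ℝ, α * (1 + s ^ 2)⁻¹ := by
    refine MeasureTheory.norm_integral_le_of_norm_le (integrable_inv_one_add_sq.const_mul α)
      (MeasureTheory.ae_of_all _ fun s => ?_)
    rw [norm_mul, Real.norm_eq_abs, Real.norm_eq_abs, abs_of_pos (by positivity : 0 < (1 + s ^ 2)⁻¹)]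
    gcongr
    exact hb _
  rw [MeasureTheory.integral_const_mul, integral_univ_inv_one_add_sq, Real.norm_eq_abs] at this
  calc _ ≤ 1 / Real.pi * (α * Real.pi) := by gcongr
    _ = α := by field_simp

/-- Boundary values of the Poisson integral at a point of continuity. -/
theorem tendsto_cauchyTransform_im (hm : Measurable θ) (hi : MeasureTheory.Integrable θ)
    (hb : ∀ t, |θ t| ≤ α) {x : ℝ} (hx : ContinuousAt θ x) :
    Tendsto (fun y : ℝ => (cauchyTransform θ ⟨x, y⟩).im) (𝓝[>] 0) (𝓝 (-θ x)) := by
  have h : Tendsto (fun y : ℝ => ∫ s : ℝ, θ (x + y * s) * (1 + s ^ 2)⁻¹) (𝓝[>] 0)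
      (𝓝 (∫ s : ℝ, θ x * (1 + s ^ 2)⁻¹)) := by
    refine MeasureTheory.tendsto_integral_filter_of_dominated_convergence
      (fun s => α * (1 + s ^ 2)⁻¹)
      (Eventually.of_forall fun y => Measurable.aestronglyMeasurable (by fun_prop))
      (Eventually.of_forall fun y => MeasureTheory.ae_of_all _ fun s => ?_)
      (integrable_inv_one_add_sq.const_mul α) (MeasureTheory.ae_of_all _ fun s => ?_)
    · rw [norm_mul, Real.norm_eq_abs, Real.norm_eq_abs,
        abs_of_pos (by positivity : 0 < (1 + s ^ 2)⁻¹)]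
      gcongr
      exact hb _
    · refine Tendsto.mul_const _ (hx.tendsto.comp ?_)
      have : Continuous fun y : ℝ => x + y * s := by fun_prop
      simpa using (this.tendsto 0).mono_left nhdsWithin_le_nhds
  rw [MeasureTheory.integral_const_mul, integral_univ_inv_one_add_sq] at h
  have h' := (h.const_mul (1 / Real.pi)).neg
  rw [show 1 / Real.pi * (θ x * Real.pi) = θ x by field_simp] at h'
  refine h'.congr' ?_
  filter_upwards [self_mem_nhdsWithin] with y hy
  exact (cauchyTransform_im hm hi x hy).symm

/-- The conjugate Poisson integral of a bounded density grows at most logarithmically. -/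
theorem abs_cauchyTransform_re_le (hm : Measurable θ) (hb : ∀ t, |θ t| ≤ α)
    (hs : ∀ t ∉ Ioo (-1 : ℝ) 1, θ t = 0) {z : ℂ} (hx : |z.re| ≤ 1) (hz : 0 < z.im)
    (hz2 : z.im ≤ 2) :
    |(cauchyTransform θ z).re| ≤ α / Real.pi * Real.log (8 / z.im ^ 2) := by
  have hi := integrable_of_bounded_of_support hm hb hs
  have hint := integrable_div_sub hm hi hz
  have hα : 0 ≤ α := (abs_nonneg _).trans (hb 0)
  set x := z.re
  set y := z.im
  have hk : Continuous fun s : ℝ => |s| / (s ^ 2 + y ^ 2) := by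
    refine continuous_abs.div (by fun_prop) fun s => ?_
    positivity
  -- the kernel `|s| / (s ^ 2 + y ^ 2)` has primitive `log (s ^ 2 + y ^ 2) / 2` for `s ≥ 0`
  have hhalf : ∫ s in (0 : ℝ)..2, |s| / (s ^ 2 + y ^ 2) =
      1 / 2 * Real.log (4 + y ^ 2) - 1 / 2 * Real.log (y ^ 2) := by
    have := intervalIntegral.integral_eq_sub_of_hasDerivAt (a := 0) (b := 2)
      (f := fun s : ℝ => 1 / 2 * Real.log (s ^ 2 + y ^ 2)) (f' := fun s => |s| / (s ^ 2 + y ^ 2))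
      (fun s hs => by
        rw [uIcc_of_le (by norm_num)] at hs
        have h1 : HasDerivAt (fun s : ℝ => s ^ 2 + y ^ 2) (2 * s) s := by
          simpa using (hasDerivAt_pow 2 s).add_const (y ^ 2)
        have h2 := (h1.log (by positivity)).const_mul (1 / 2)
        convert! h2 using 1
        rw [abs_of_nonneg hs.1]; ring) (hk.intervalIntegrable _ _)
    rw [this]; norm_num
  have hneg : ∫ s in (-2 : ℝ)..0, |s| / (s ^ 2 + y ^ 2) = ∫ s in (0 : ℝ)..2, |s| / (s ^ 2 + y ^ 2) := by
    have := intervalIntegral.integral_comp_neg (a := 0) (b := 2)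
      (fun s : ℝ => |s| / (s ^ 2 + y ^ 2))
    simpa using this.symm
  have hfull : ∫ s in (-2 : ℝ)..2, |s| / (s ^ 2 + y ^ 2) ≤ Real.log (8 / y ^ 2) := by
    rw [← intervalIntegral.integral_add_adjacent_intervals (hk.intervalIntegrable (-2) 0)
      (hk.intervalIntegrable 0 2), hneg, hhalf, Real.log_div (by norm_num) (by positivity)]
    have : Real.log (4 + y ^ 2) ≤ Real.log 8 := Real.log_le_log (by positivity) (by nlinarith)
    linarith
  have hshift : ∫ t in (x - 2)..(x + 2), |t - x| / ((t - x) ^ 2 + y ^ 2) =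
      ∫ s in (-2 : ℝ)..2, |s| / (s ^ 2 + y ^ 2) := by
    have := intervalIntegral.integral_comp_sub_right (a := x - 2) (b := x + 2)
      (fun s : ℝ => |s| / (s ^ 2 + y ^ 2)) x
    rw [this]; congr 1 <;> ring
  have hks : Continuous fun t : ℝ => |t - x| / ((t - x) ^ 2 + y ^ 2) :=
    hk.comp (continuous_id.sub continuous_const)
  have hxb := abs_le.1 hx
  rw [cauchyTransform, Complex.re_ofReal_mul, abs_mul, abs_of_pos (by positivity : 0 < 1 / Real.pi),
    show (∫ t : ℝ, (θ t : ℂ) / (z - t)).re = ∫ t : ℝ, ((θ t : ℂ) / (z - t)).re from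
      (integral_re hint).symm]
  have hmain : ‖∫ t : ℝ, ((θ t : ℂ) / (z - t)).re‖ ≤
      ∫ t in Ioc (x - 2) (x + 2), α * (|t - x| / ((t - x) ^ 2 + y ^ 2)) := by
    rw [← MeasureTheory.integral_indicator measurableSet_Ioc]
    refine MeasureTheory.norm_integral_le_of_norm_le ?_ (MeasureTheory.ae_of_all _ fun t => ?_)
    · rw [MeasureTheory.integrable_indicator_iff measurableSet_Ioc]
      exact ((hks.const_mul α).integrableOn_Icc).mono_set Ioc_subset_Icc_self
    · by_cases ht : t ∈ Ioo (-1 : ℝ) 1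
      · rw [indicator_of_mem (show t ∈ Ioc (x - 2) (x + 2) from
          ⟨by linarith [ht.1, hxb.2], by linarith [ht.2, hxb.1]⟩)]
        have : ((θ t : ℂ) / (z - t)).re = θ t * ((x - t) / ((t - x) ^ 2 + y ^ 2)) := by
          rw [Complex.div_re, Complex.normSq_apply]
          simp [x, y]
          ring
        rw [this, norm_mul, Real.norm_eq_abs, Real.norm_eq_abs, abs_div, abs_sub_comm x t,
          abs_of_pos (by positivity : 0 < (t - x) ^ 2 + y ^ 2)]
        gcongr
        exact hb t
      · rw [hs t ht]
        simp only [Complex.ofReal_zero, zero_div, Complex.zero_re, norm_zero]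
        exact indicator_nonneg (fun t _ => by positivity) _
  rw [MeasureTheory.integral_const_mul, ← intervalIntegral.integral_of_le (by linarith), hshift]
    at hmain
  calc _ ≤ 1 / Real.pi * (α * Real.log (8 / y ^ 2)) := by
        gcongr
        exact hmain.trans (by gcongr)
    _ = _ := by ring

/-- Exponentiating the logarithmic bound: when `p |θ| ≤ π / 2`, the function
`exp (p * cauchyTransform θ)` is at most of order `1 / Im z`. -/
theorem norm_exp_mul_cauchyTransform_le (hm : Measurable θ) (hb : ∀ t, |θ t| ≤ α)
    (hs : ∀ t ∉ Ioo (-1 : ℝ) 1, θ t = 0) {p : ℝ} (hp : 0 ≤ p) (hpα : p * α ≤ Real.pi / 2) {z : ℂ}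
    (hx : |z.re| ≤ 1) (hz : 0 < z.im) (hz2 : z.im ≤ 2) :
    ‖Complex.exp (p * cauchyTransform θ z)‖ ≤ 3 / z.im := by
  have h := abs_cauchyTransform_re_le hm hb hs hx hz hz2
  have hlog : 0 ≤ Real.log (8 / z.im ^ 2) := by
    refine Real.log_nonneg ?_
    rw [le_div_iff₀ (by positivity)]
    nlinarith
  have h9 : Real.log (8 / z.im ^ 2) ≤ 2 * Real.log (3 / z.im) := by
    rw [show 2 * Real.log (3 / z.im) = Real.log ((3 / z.im) ^ 2) by rw [Real.log_pow]; norm_num]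
    refine Real.log_le_log (by positivity) ?_
    rw [div_pow]
    gcongr
    norm_num
  rw [Complex.norm_exp, Complex.re_ofReal_mul, ← Real.le_log_iff_exp_le (by positivity)]
  calc p * (cauchyTransform θ z).re ≤ p * (α / Real.pi * Real.log (8 / z.im ^ 2)) := by
        gcongr
        exact (le_abs_self _).trans h
    _ = (p * α) / Real.pi * Real.log (8 / z.im ^ 2) := by ring
    _ ≤ (Real.pi / 2) / Real.pi * Real.log (8 / z.im ^ 2) := by gcongr
    _ = 1 / 2 * Real.log (8 / z.im ^ 2) := by field_simp
    _ ≤ _ := by linarith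

end CauchyTransform

/-! ### Fourier coefficients of a function on a half period -/

/-- A continuous function on the circle is determined by its Fourier coefficients. -/
theorem eqOn_zero_of_integral_mul_exp_eq_zero {A : ℝ → ℂ} (hA : Continuous A)
    (hper : A (-Real.pi) = A Real.pi)
    (h : ∀ n : ℤ, ∫ φ in (-Real.pi)..Real.pi, A φ * Complex.exp (n * φ * Complex.I) = 0) :
    ∀ φ ∈ Ico (-Real.pi) Real.pi, A φ = 0 := by
  intro φ hφ
  have hpi : -Real.pi + 2 * Real.pi = Real.pi := by ring
  have : Fact (0 < 2 * Real.pi) := ⟨Real.two_pi_pos⟩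
  let g : C(AddCircle (2 * Real.pi), ℂ) := ⟨AddCircle.liftIco (2 * Real.pi) (-Real.pi) A,
    AddCircle.liftIco_continuous (by rw [hpi, hper]) hA.continuousOn⟩
  have hg : ∀ n, fourierCoeff g n = 0 := by
    intro n
    change fourierCoeff (AddCircle.liftIco (2 * Real.pi) (-Real.pi) A) n = 0
    rw [fourierCoeff_liftIco_eq, fourierCoeffOn_eq_integral]
    have e : -Real.pi + 2 * Real.pi - -Real.pi = 2 * Real.pi := by ring
    rw [smul_eq_zero]; right
    rw [← h (-n), hpi]
    congr 1; ext x
    rw [smul_eq_mul, mul_comm, fourier_coe_apply]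
    congr 2
    have := Real.pi_ne_zero
    push_cast
    have : (Real.pi : ℂ) ≠ 0 := by exact_mod_cast this
    field_simp
    ring
  have hs : Summable (fourierCoeff g) := by
    rw [show fourierCoeff g = fun _ => 0 from funext hg]; exact summable_zero
  have hsum := has_pointwise_sum_fourier_series_of_summable hs (φ : AddCircle (2 * Real.pi))
  simp only [hg, zero_smul] at hsum
  have h0 := hsum.unique hasSum_zero
  rw [← h0]
  exact (AddCircle.liftIco_coe_apply (by rw [hpi]; exact hφ)).symm

/-- Vanishing of the real parts of the Fourier coefficients suffices for a function supported in a
half period: `a φ + conj (a (-φ))` has those real parts, doubled, as its coefficients, and its two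
summands have disjoint supports. -/
theorem eq_zero_of_re_integral_mul_exp_eq_zero {a : ℝ → ℂ} (ha : Continuous a)
    (h0 : ∀ φ ∉ Ioo 0 Real.pi, a φ = 0)
    (h : ∀ n : ℤ, (∫ φ in (0 : ℝ)..Real.pi, a φ * Complex.exp (n * φ * Complex.I)).re = 0) :
    ∀ φ, a φ = 0 := by
  have hpi := Real.pi_pos
  have hz := eqOn_zero_of_integral_mul_exp_eq_zero
    (A := fun φ => a φ + starRingEnd ℂ (a (-φ))) (by fun_prop)
    (by simp [h0 Real.pi (by simp), h0 (-Real.pi) (by simp [hpi.le])]) (fun n => by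
      set g : ℝ → ℂ := fun φ => a φ * Complex.exp (n * φ * Complex.I) with hg
      have hgc : Continuous g := by fun_prop
      have hneg : ∀ φ : ℝ, φ ≤ 0 → a φ = 0 := fun φ hφ => h0 φ fun h' => hφ.not_gt h'.1
      have e1 : ∫ φ in (-Real.pi)..Real.pi, g φ = ∫ φ in (0 : ℝ)..Real.pi, g φ := by
        rw [← intervalIntegral.integral_add_adjacent_intervals
          (hgc.intervalIntegrable (-Real.pi) 0) (hgc.intervalIntegrable 0 Real.pi)]
        rw [intervalIntegral.integral_congr (g := fun _ => 0), intervalIntegral.integral_zero,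
          zero_add]
        intro φ hφ
        rw [uIcc_of_le (by linarith)] at hφ
        simp [hg, hneg φ hφ.2]
      have e2 : ∫ φ in (-Real.pi)..Real.pi, starRingEnd ℂ (g (-φ)) =
          starRingEnd ℂ (∫ φ in (-Real.pi)..Real.pi, g φ) := by
        rw [intervalIntegral.integral_comp_neg (fun φ => starRingEnd ℂ (g φ)), neg_neg]
        simp only [intervalIntegral.integral_of_le (by linarith : -Real.pi ≤ Real.pi)]
        exact integral_conj
      have e3 : ∀ φ : ℝ, (a φ + starRingEnd ℂ (a (-φ))) * Complex.exp (n * φ * Complex.I) =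
          g φ + starRingEnd ℂ (g (-φ)) := by
        intro φ
        simp only [hg, map_mul, ← Complex.exp_conj, Complex.conj_I, Complex.conj_ofReal,
          map_intCast]
        push_cast
        ring_nf
      simp only [e3]
      have hgi : Continuous fun φ => starRingEnd ℂ (g (-φ)) := by fun_prop
      rw [intervalIntegral.integral_add (hgc.intervalIntegrable _ _) (hgi.intervalIntegrable _ _),
        e2, e1, Complex.add_conj, h n]
      simp)
  intro φ
  by_cases hφ : φ ∈ Ioo 0 Real.pi
  · have := hz φ ⟨by linarith [hφ.1], hφ.2⟩
    simpa [h0 (-φ) (fun h' => by linarith [hφ.1, h'.1])] using this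
  · exact h0 φ hφ

/-! ### Weak boundary values on the diameter -/

section HalfDisc

variable {θ : ℝ → ℝ} {α : ℝ} {r : ℝ}

/-- On the circle `|z| = r` the weight `(r² - z²)²` is, up to a unimodular factor, `4 r² (Im z)²`. -/
theorem sq_sub_sq_circle (r φ : ℝ) :
    ((r : ℂ) ^ 2 - (r * Complex.exp (φ * Complex.I)) ^ 2) ^ 2 =
      ((-4 * r ^ 4 * Real.sin φ ^ 2 : ℝ) : ℂ) * Complex.exp (φ * Complex.I) ^ 2 := by
  have h1 := Complex.sin_sq_add_cos_sq (φ : ℂ)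
  rw [Complex.exp_mul_I]
  push_cast
  set c := Complex.cos φ
  set s := Complex.sin φ
  have h : (r : ℂ) ^ 2 - (r * (c + s * Complex.I)) ^ 2 =
      -2 * r ^ 2 * s * Complex.I * (c + s * Complex.I) := by
    linear_combination (-(r : ℂ) ^ 2) * h1 - (-(r : ℂ) ^ 2 * s ^ 2) * Complex.I_sq
  rw [h]
  linear_combination (4 * (r : ℂ) ^ 4 * s ^ 2 * (c + s * Complex.I) ^ 2) * Complex.I_sq

theorem circle_im (r φ : ℝ) : ((r : ℂ) * Complex.exp (φ * Complex.I)).im = r * Real.sin φ := by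
  rw [Complex.im_ofReal_mul, Complex.exp_ofReal_mul_I_im]

theorem norm_circle (hr : 0 ≤ r) (φ : ℝ) : ‖(r : ℂ) * Complex.exp (φ * Complex.I)‖ = r := by
  rw [norm_mul, Complex.norm_exp_ofReal_mul_I, mul_one, Complex.norm_real, Real.norm_of_nonneg hr]

/-- The weight `(r² - z²)²` absorbs the growth of `exp (p * cauchyTransform θ)` at the end points of
the arc, uniformly in the upward shift `ε`. -/
theorem norm_exp_mul_cauchyTransform_mul_weight_le (hm : Measurable θ) (hb : ∀ t, |θ t| ≤ α)
    (hs : ∀ t ∉ Ioo (-1 : ℝ) 1, θ t = 0) {p : ℝ} (hp : 0 ≤ p) (hpα : p * α ≤ Real.pi / 2)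
    (hr : r ∈ Ioo 0 1) {ε : ℝ} (hε : ε ∈ Icc 0 1) {φ : ℝ} (hφ : φ ∈ Ioo 0 Real.pi) :
    ‖Complex.exp (p * cauchyTransform θ (r * Complex.exp (φ * Complex.I) + ε * Complex.I)) *
      ((r : ℂ) ^ 2 - (r * Complex.exp (φ * Complex.I)) ^ 2) ^ 2‖ ≤ 12 * Real.sin φ := by
  have hsin := Real.sin_pos_of_mem_Ioo hφ
  have hrs : 0 < r * Real.sin φ := mul_pos hr.1 hsin
  set z : ℂ := r * Complex.exp (φ * Complex.I)
  have him : (z + ε * Complex.I).im = r * Real.sin φ + ε := by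
    rw [Complex.add_im, circle_im]; simp
  have hre : |(z + ε * Complex.I).re| ≤ 1 := by
    have : (z + ε * Complex.I).re = z.re := by simp
    rw [this]
    exact (Complex.abs_re_le_norm z).trans ((norm_circle hr.1.le φ).le.trans hr.2.le)
  have hrs1 : r * Real.sin φ ≤ 1 :=
    mul_le_one₀ hr.2.le hsin.le (Real.sin_le_one φ)
  have h := norm_exp_mul_cauchyTransform_le hm hb hs hp hpα hre (by rw [him]; linarith [hε.1])
    (by rw [him]; linarith [hε.2])
  rw [him] at h
  rw [norm_mul, sq_sub_sq_circle, norm_mul, norm_pow, Complex.norm_exp_ofReal_mul_I, one_pow,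
    mul_one, Complex.norm_real, Real.norm_eq_abs, neg_mul, neg_mul, abs_neg,
    abs_of_nonneg (by positivity)]
  calc _ ≤ 3 / (r * Real.sin φ) * (4 * r ^ 4 * Real.sin φ ^ 2) := by
        gcongr
        refine h.trans ?_
        gcongr
        linarith [hε.1]
    _ = 12 * Real.sin φ * r ^ 3 := by
        have := hr.1.ne'
        have := hsin.ne'
        field_simp
        ring
    _ ≤ 12 * Real.sin φ * 1 := by
        gcongr
        exact pow_le_one₀ hr.1.le hr.2.le
    _ = _ := mul_one _

theorem differentiableOn_exp_cauchyTransform_shift (hm : Measurable θ)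
    (hi : MeasureTheory.Integrable θ) (p : ℝ) {ε : ℝ} :
    DifferentiableOn ℂ (fun z => Complex.exp (p * cauchyTransform θ (z + ε * Complex.I)))
      {z | -ε < z.im} := by
  refine DifferentiableOn.cexp (DifferentiableOn.const_mul ?_ _)
  refine (differentiableOn_cauchyTransform hm hi).comp (by fun_prop) fun z (hz : -ε < z.im) => ?_
  simp only [mem_ofPred_eq, Complex.add_im, Complex.im_ofReal_mul, Complex.I_im]
  linarith

theorem norm_exp_mul_cos_le_re {w : ℂ} (hw : |w.im| ≤ α) (hα2 : α ≤ Real.pi) :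
    ‖Complex.exp w‖ * Real.cos α ≤ (Complex.exp w).re := by
  rw [Complex.exp_re, Complex.norm_exp, ← Real.cos_abs w.im]
  gcongr
  exact Real.cos_le_cos_of_nonneg_of_le_pi (abs_nonneg _) hα2 hw

/-- A bound, uniform in `ε`, for the weighted `L^p` norm of `exp (cauchyTransform θ)` on the line
`Im z = ε`. When `p |θ| ≤ p α < π / 2`, the function `exp (p * cauchyTransform θ)` takes values in a
sector where its norm is controlled by its real part, and the integral of the real part is moved to
the arc by Cauchy's theorem. -/
theorem integral_norm_exp_mul_weight_le (hm : Measurable θ) (hb : ∀ t, |θ t| ≤ α)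
    (hs : ∀ t ∉ Ioo (-1 : ℝ) 1, θ t = 0) {p : ℝ} (hp : 0 ≤ p) (hpα : p * α < Real.pi / 2)
    (hr : r ∈ Ioo 0 1) {ε : ℝ} (hε : ε ∈ Ioc 0 1) :
    ∫ x in (-r)..r, ‖Complex.exp (p * cauchyTransform θ ((x : ℝ) + ε * Complex.I))‖ *
      (r ^ 2 - x ^ 2) ^ 2 ≤ 12 * Real.pi / Real.cos (p * α) := by
  have hi := integrable_of_bounded_of_support hm hb hs
  have hα : 0 ≤ α := (abs_nonneg _).trans (hb 0)
  have hrr : -r ≤ r := by linarith [hr.1]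
  have hcos : 0 < Real.cos (p * α) :=
    Real.cos_pos_of_mem_Ioo ⟨by nlinarith [Real.pi_pos], hpα⟩
  have hd := differentiableOn_exp_cauchyTransform_shift hm hi p (ε := ε)
  have hd' : DifferentiableOn ℂ (fun z : ℂ => Complex.exp (p * cauchyTransform θ
      (z + ε * Complex.I)) * ((r : ℂ) ^ 2 - z ^ 2) ^ 2) {z | -ε < z.im} :=
    hd.mul (by fun_prop)
  have hc := integral_diameter_add_integral_arc_eq_zero hr.1
    (hd'.continuousOn.mono fun z hz => by
      have := hz.2
      simp only [mem_ofPred_eq]; linarith [hε.1])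
    (hd'.mono fun z hz => by
      have := hz.2
      simp only [mem_ofPred_eq]; linarith [hε.1])
  have hline : ContinuousOn (fun x : ℝ =>
      Complex.exp (p * cauchyTransform θ ((x : ℝ) + ε * Complex.I))) univ :=
    hd.continuousOn.comp (f := fun x : ℝ => (x : ℂ)) (by fun_prop) fun x _ => by
      simpa using hε.1
  rw [continuousOn_univ] at hline
  have hF : Continuous (fun x : ℝ => Complex.exp (p * cauchyTransform θ
      ((x : ℂ) + ε * Complex.I)) * ((r : ℂ) ^ 2 - (x : ℂ) ^ 2) ^ 2) := by fun_prop
  have harc : ‖∫ φ in (0 : ℝ)..Real.pi, Complex.exp (p * cauchyTransform θ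
      (r * Complex.exp (φ * Complex.I) + ε * Complex.I)) *
      ((r : ℂ) ^ 2 - (r * Complex.exp (φ * Complex.I)) ^ 2) ^ 2 *
        (r * Complex.exp (φ * Complex.I) * Complex.I)‖ ≤ 12 * |Real.pi - 0| := by
    refine intervalIntegral.norm_integral_le_of_norm_le_const_ae ?_
    filter_upwards [MeasureTheory.Measure.ae_ne MeasureTheory.volume Real.pi] with φ hne hφ
    rw [uIoc_of_le Real.pi_pos.le] at hφ
    have hφ' : φ ∈ Ioo 0 Real.pi := ⟨hφ.1, lt_of_le_of_ne hφ.2 hne⟩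
    have h1 := norm_exp_mul_cauchyTransform_mul_weight_le hm hb hs hp hpα.le hr
      ⟨hε.1.le, hε.2⟩ hφ'
    rw [norm_mul, norm_mul _ Complex.I, norm_circle hr.1.le, Complex.norm_I, mul_one]
    calc _ ≤ (12 * Real.sin φ) * r := by gcongr; exact hr.1.le
      _ ≤ 12 * 1 * 1 := by
        gcongr
        · exact hr.1.le
        · exact Real.sin_le_one φ
        · exact hr.2.le
      _ = 12 := by norm_num
  rw [sub_zero, abs_of_pos Real.pi_pos] at harc
  rw [le_div_iff₀ hcos, ← intervalIntegral.integral_mul_const]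
  have hre : (∫ x in (-r)..r, Complex.exp (p * cauchyTransform θ
      ((x : ℝ) + ε * Complex.I)) * ((r : ℂ) ^ 2 - (x : ℂ) ^ 2) ^ 2).re =
      ∫ x in (-r)..r, (Complex.exp (p * cauchyTransform θ ((x : ℝ) + ε * Complex.I))).re *
        (r ^ 2 - x ^ 2) ^ 2 := by
    have := Complex.reCLM.intervalIntegral_comp_comm
      (hF.intervalIntegrable (μ := MeasureTheory.volume) (-r) r)
    simp only [Complex.reCLM_apply] at this
    rw [← this]
    congr 1; ext x
    rw [show ((r : ℂ) ^ 2 - (x : ℂ) ^ 2) ^ 2 = (((r ^ 2 - x ^ 2) ^ 2 : ℝ) : ℂ) by push_cast; rfl,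
      Complex.re_mul_ofReal]
  calc _ ≤ ∫ x in (-r)..r, (Complex.exp (p * cauchyTransform θ ((x : ℝ) + ε * Complex.I))).re *
        (r ^ 2 - x ^ 2) ^ 2 := by
        refine intervalIntegral.integral_mono_on hrr
          (Continuous.intervalIntegrable (by fun_prop) _ _)
          (Continuous.intervalIntegrable (by fun_prop) _ _) fun x _ => ?_
        rw [mul_right_comm]
        gcongr
        refine norm_exp_mul_cos_le_re ?_ (by linarith [Real.pi_pos])
        rw [Complex.im_ofReal_mul, abs_mul, abs_of_nonneg hp]
        gcongr
        exact abs_cauchyTransform_im_le hm hi hb (by simpa using hε.1)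
    _ ≤ _ := by
        rw [← hre]
        refine (Complex.re_le_norm _).trans ?_
        rwa [eq_neg_of_add_eq_zero_left hc, norm_neg]

/-- If `v e^{-iθ}` is real on the diameter then `v * exp (cauchyTransform θ)` has real boundary values
there in the weak sense: its imaginary part, integrated against the weight on the line `Im z = ε`,
tends to `0`. The `L^p` bound with `p > 1` supplies the uniform integrability. -/
theorem tendsto_integral_im_mul_exp (hm : Measurable θ) (hb : ∀ t, |θ t| ≤ α)
    (hs : ∀ t ∉ Ioo (-1 : ℝ) 1, θ t = 0) (hα2 : α < Real.pi / 2) (hr : r ∈ Ioo 0 1)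
    {v : ℝ → ℂ} (hv : ContinuousOn v (Icc (-r) r))
    (hreal : ∀ x ∈ Icc (-r) r, (v x * Complex.exp (-θ x * Complex.I)).im = 0)
    (hcont : ∀ x ∈ Icc (-r) r, v x = 0 ∨ ContinuousAt θ x) :
    Tendsto (fun ε : ℝ => ∫ x in (-r)..r,
      (v x * Complex.exp (cauchyTransform θ ((x : ℝ) + ε * Complex.I))).im * (r ^ 2 - x ^ 2) ^ 2)
      (𝓝[>] 0) (𝓝 0) := by
  have hi := integrable_of_bounded_of_support hm hb hs
  have hrr : -r ≤ r := by linarith [hr.1]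
  obtain ⟨p, hp1, hpα⟩ : ∃ p : ℝ, 1 < p ∧ p * α < Real.pi / 2 := by
    have hcont : Continuous fun p : ℝ => p * α := by fun_prop
    have hev : ∀ᶠ p in 𝓝[>] (1 : ℝ), p * α < Real.pi / 2 :=
      ((hcont.tendsto 1).eventually_lt_const (by simpa using hα2)).filter_mono nhdsWithin_le_nhds
    obtain ⟨p, h1, h2⟩ := (hev.and self_mem_nhdsWithin).exists
    exact ⟨p, h2, h1⟩
  obtain ⟨B, hB⟩ := isCompact_Icc.exists_bound_of_continuousOn hv
  have hB0 : 0 ≤ B := (norm_nonneg _).trans (hB r ⟨hrr, le_rfl⟩)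
  set K := 12 * Real.pi / Real.cos (p * α)
  -- only the phase of `exp (cauchyTransform θ)` is kept in `s`; it is unimodular and tends to
  -- `e^{-iθ}` wherever `v` does not vanish, so dominated convergence applies to `s`
  set s : ℝ → ℝ → ℝ := fun ε x => |(v x * Complex.exp
    ((cauchyTransform θ ((x : ℝ) + ε * Complex.I)).im * Complex.I)).im| * (r ^ 2 - x ^ 2) ^ 2 with hsdef
  have hLc : ∀ ε : ℝ, 0 < ε → Continuous fun x : ℝ => cauchyTransform θ ((x : ℝ) + ε * Complex.I) := by
    intro ε hε
    rw [← continuousOn_univ]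
    exact (differentiableOn_cauchyTransform hm hi).continuousOn.comp (by fun_prop)
      fun x _ => by simpa using hε
  have hscont : ∀ ε : ℝ, 0 < ε → ContinuousOn (s ε) (Icc (-r) r) := by
    intro ε hε
    have := Complex.continuous_im.comp (hLc ε hε)
    simp only [Function.comp_def] at this
    refine ContinuousOn.mul (continuous_abs.comp_continuousOn
      (Complex.continuous_im.comp_continuousOn (hv.mul ?_))) (by fun_prop)
    exact Continuous.continuousOn (by fun_prop)
  have hnv : ∀ x ∈ Icc (-r) r, ∀ y : ℝ, |(v x * Complex.exp (y * Complex.I)).im| ≤ B := by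
    intro x hx y
    refine (Complex.abs_im_le_norm _).trans ?_
    rw [norm_mul, Complex.norm_exp_ofReal_mul_I, mul_one]
    exact hB x hx
  have hslim : Tendsto (fun ε => ∫ x in (-r)..r, s ε x) (𝓝[>] 0) (𝓝 0) := by
    have h0 : ∫ _ in (-r)..r, (0 : ℝ) = 0 := intervalIntegral.integral_zero
    suffices Tendsto (fun ε => ∫ x in (-r)..r, s ε x) (𝓝[>] 0) (𝓝 (∫ _ in (-r)..r, (0 : ℝ))) by
      rwa [h0] at this
    refine intervalIntegral.tendsto_integral_filter_of_dominated_convergence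
      (fun x => B * (r ^ 2 - x ^ 2) ^ 2) ?_ ?_ (Continuous.intervalIntegrable (by fun_prop) _ _) ?_
    · filter_upwards [self_mem_nhdsWithin] with ε hε
      rw [uIoc_of_le hrr]
      exact ((hscont ε hε).mono Ioc_subset_Icc_self).aestronglyMeasurable measurableSet_Ioc
    · refine Eventually.of_forall fun ε => MeasureTheory.ae_of_all _ fun x hx => ?_
      rw [uIoc_of_le hrr] at hx
      rw [hsdef, norm_mul, Real.norm_eq_abs, Real.norm_eq_abs, abs_abs,
        abs_of_nonneg (sq_nonneg (r ^ 2 - x ^ 2))]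
      gcongr
      exact hnv x (Ioc_subset_Icc_self hx) _
    · refine MeasureTheory.ae_of_all _ fun x hx => ?_
      rw [uIoc_of_le hrr] at hx
      have hx' := Ioc_subset_Icc_self hx
      rcases hcont x hx' with h0 | hc
      · simp [hsdef, h0]
      · have h1 := tendsto_cauchyTransform_im hm hi hb hc
        have h2 : Continuous fun y : ℝ =>
          |(v x * Complex.exp (y * Complex.I)).im| * (r ^ 2 - x ^ 2) ^ 2 := by fun_prop
        have h3 := (h2.tendsto (-θ x)).comp h1
        have h4 := hreal x hx'
        simp only [Complex.ofReal_neg, h4, abs_zero, zero_mul] at h3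
        refine h3.congr fun ε => ?_
        simp only [hsdef, Function.comp]
        rw [Complex.mk_eq_add_mul_I]
  -- `h ≤ e^m + e^{-(p-1)m} h^p` for `h = ‖exp (cauchyTransform θ)‖` and every threshold `e^m`
  have hbound : ∀ m : ℝ, ∀ ε ∈ Ioc (0 : ℝ) 1, |∫ x in (-r)..r,
      (v x * Complex.exp (cauchyTransform θ ((x : ℝ) + ε * Complex.I))).im * (r ^ 2 - x ^ 2) ^ 2| ≤
      Real.exp m * (∫ x in (-r)..r, s ε x) + Real.exp (-(p - 1) * m) * B * K := by
    intro m ε hε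
    have hL := hLc ε hε.1
    set L : ℝ → ℂ := fun x => cauchyTransform θ ((x : ℝ) + ε * Complex.I) with hLdef
    have hsi : IntervalIntegrable (s ε) MeasureTheory.volume (-r) r := by
      apply ContinuousOn.intervalIntegrable
      rw [uIcc_of_le hrr]; exact hscont ε hε.1
    have hPi : IntervalIntegrable (fun x => ‖Complex.exp (p * L x)‖ * (r ^ 2 - x ^ 2) ^ 2)
        MeasureTheory.volume (-r) r := Continuous.intervalIntegrable (by fun_prop) _ _
    have hpt : ∀ x ∈ Icc (-r) r, ‖(v x * Complex.exp (L x)).im * (r ^ 2 - x ^ 2) ^ 2‖ ≤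
        Real.exp m * s ε x + Real.exp (-(p - 1) * m) * B *
          (‖Complex.exp (p * L x)‖ * (r ^ 2 - x ^ 2) ^ 2) := by
      intro x hx
      have e1 : Complex.exp (L x) = (Real.exp (L x).re : ℂ) *
          Complex.exp ((L x).im * Complex.I) := by
        rw [Complex.ofReal_exp, ← Complex.exp_add, Complex.re_add_im]
      have e2 : (v x * Complex.exp (L x)).im =
          Real.exp (L x).re * (v x * Complex.exp ((L x).im * Complex.I)).im := by
        rw [e1, mul_left_comm, Complex.im_ofReal_mul]
      rw [norm_mul, Real.norm_eq_abs, Real.norm_eq_abs,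
        abs_of_nonneg (sq_nonneg (r ^ 2 - x ^ 2)), e2, abs_mul,
        abs_of_pos (Real.exp_pos _), Complex.norm_exp, Complex.re_ofReal_mul]
      have hq : 0 ≤ (r ^ 2 - x ^ 2) ^ 2 := sq_nonneg _
      have hh : Real.exp (L x).re ≤ Real.exp m ∨
          Real.exp (L x).re ≤ Real.exp (-(p - 1) * m) * Real.exp (p * (L x).re) := by
        rcases le_total (L x).re m with h | h
        · exact Or.inl (Real.exp_le_exp.2 h)
        · right
          rw [← Real.exp_add]
          refine Real.exp_le_exp.2 ?_
          nlinarith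
      have hn := hnv x hx (L x).im
      have hsx : s ε x = |(v x * Complex.exp ((L x).im * Complex.I)).im| * (r ^ 2 - x ^ 2) ^ 2 := rfl
      rw [hsx]
      rcases hh with h | h
      · have : 0 ≤ Real.exp (-(p - 1) * m) * B * (Real.exp (p * (L x).re) * (r ^ 2 - x ^ 2) ^ 2) := by
          positivity
        refine le_trans ?_ (le_add_of_nonneg_right this)
        rw [mul_assoc]
        gcongr
      · refine le_trans ?_ (le_add_of_nonneg_left (by positivity))
        calc _ ≤ (Real.exp (-(p - 1) * m) * Real.exp (p * (L x).re)) * B * (r ^ 2 - x ^ 2) ^ 2 := by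
              gcongr
          _ = _ := by ring
    have hle := intervalIntegral.norm_integral_le_of_norm_le (μ := MeasureTheory.volume) hrr
      (MeasureTheory.ae_of_all _ fun x hx => hpt x (Ioc_subset_Icc_self hx))
      ((hsi.const_mul _).add (hPi.const_mul _))
    rw [intervalIntegral.integral_add (hsi.const_mul _) (hPi.const_mul _),
      intervalIntegral.integral_const_mul, intervalIntegral.integral_const_mul] at hle
    refine hle.trans ?_
    gcongr
    exact integral_norm_exp_mul_weight_le hm hb hs (by linarith) hpα hr hε
  rw [Metric.tendsto_nhds]
  intro η hη
  have hm0 : Tendsto (fun m : ℝ => Real.exp (-(p - 1) * m) * B * K) atTop (𝓝 0) := by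
    have h1 : Tendsto (fun m : ℝ => -(p - 1) * m) atTop atBot :=
      tendsto_id.const_mul_atTop_of_neg (by linarith)
    simpa using ((Real.tendsto_exp_atBot.comp h1).mul_const B).mul_const K
  obtain ⟨m, hm'⟩ := (hm0.eventually_lt_const (half_pos hη)).exists
  have hs0 := hslim.const_mul (Real.exp m)
  rw [mul_zero] at hs0
  filter_upwards [hs0.eventually_lt_const (half_pos hη), Ioc_mem_nhdsGT one_pos] with ε h1 h2
  rw [Real.dist_eq, sub_zero]
  exact (hbound m ε h2).trans_lt (by linarith)

end HalfDisc

/-! ### Points of the half disc and of the cone -/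

theorem im_mul_exp_neg_arctan_eq_zero {z : ℂ} (hz : z.re = 0 → z.im = 0) :
    (z * Complex.exp (-Real.arctan (z.im / z.re) * Complex.I)).im = 0 := by
  rw [← Complex.ofReal_neg, Complex.mul_im, Complex.exp_ofReal_mul_I_im,
    Complex.exp_ofReal_mul_I_re, Real.sin_neg, Real.cos_neg, Real.sin_arctan, Real.cos_arctan]
  rcases eq_or_ne z.re 0 with h | h
  · simp [h, hz h]
  · field_simp
    ring

theorem abs_arctan_im_div_re_le {C : ℝ} (hC : 0 ≤ C) {z : ℂ} (hz : z ∈ coneGamma C) :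
    |Real.arctan (z.im / z.re)| ≤ Real.arctan C := by
  have h : |z.im / z.re| ≤ C := by
    rw [abs_div]
    exact div_le_of_le_mul₀ (abs_nonneg _) hC hz
  rw [abs_le, ← Real.arctan_neg]
  exact ⟨Real.arctan_mono (abs_le.1 h).1, Real.arctan_mono (abs_le.1 h).2⟩

theorem circle_mem_closedHalfDisc {r φ : ℝ} (hr : 0 ≤ r) (hφ : φ ∈ Icc 0 Real.pi) :
    (r : ℂ) * Complex.exp (φ * Complex.I) ∈ {z : ℂ | ‖z‖ ≤ r ∧ 0 ≤ z.im} := by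
  refine ⟨(norm_circle hr φ).le, ?_⟩
  rw [circle_im]
  exact mul_nonneg hr (Real.sin_nonneg_of_nonneg_of_le_pi hφ.1 hφ.2)

theorem closedHalfDisc_subset {r : ℝ} (hr : r < 1) :
    {z : ℂ | ‖z‖ ≤ r ∧ 0 ≤ z.im} ⊆ upperHalfDisc ∪ openDiameter := by
  rintro z ⟨h1, h2⟩
  rcases h2.eq_or_lt with h | h
  · right
    have hz : z = (z.re : ℂ) := Complex.ext (by simp) (by simp [h.symm])
    refine ⟨z.re, ?_, hz.symm⟩
    rw [hz, Complex.norm_real, Real.norm_eq_abs] at h1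
    exact abs_lt.1 (h1.trans_lt hr)
  · exact Or.inl ⟨h1.trans_lt hr, h⟩

/-! ### The integral identity on an arc -/

/-- If `g e^{-iθ}` is real on the diameter, then `g * exp (cauchyTransform θ)` satisfies on the arc
`|z| = r` the integral identity that real boundary values on the diameter would give, by
Cauchy's theorem. It is obtained by shifting `exp (cauchyTransform θ)` up by `ε`, where Cauchy's theorem
applies, and letting `ε → 0`. -/
theorem re_integral_arc_eq_zero {θ : ℝ → ℝ} {α r : ℝ} (hm : Measurable θ) (hb : ∀ t, |θ t| ≤ α)
    (hs : ∀ t ∉ Ioo (-1 : ℝ) 1, θ t = 0) (hα2 : α < Real.pi / 2) (hr : r ∈ Ioo 0 1)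
    {g : ℂ → ℂ} (hd : DifferentiableOn ℂ g upperHalfDisc)
    (hc : ContinuousOn g (upperHalfDisc ∪ openDiameter))
    (hreal : ∀ x ∈ Ioo (-1 : ℝ) 1, (g x * Complex.exp (-θ x * Complex.I)).im = 0)
    (hcont : ∀ x ∈ Ioo (-1 : ℝ) 1, g x = 0 ∨ ContinuousAt θ x) :
    (∫ φ in (0 : ℝ)..Real.pi, g (r * Complex.exp (φ * Complex.I)) *
      Complex.exp (cauchyTransform θ (r * Complex.exp (φ * Complex.I))) *
      ((r : ℂ) ^ 2 - (r * Complex.exp (φ * Complex.I)) ^ 2) ^ 2 *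
        (r * Complex.exp (φ * Complex.I))).re = 0 := by
  have hi := integrable_of_bounded_of_support hm hb hs
  have hrr : -r ≤ r := by linarith [hr.1]
  have hsub := closedHalfDisc_subset hr.2
  have hIcc : Icc (-r) r ⊆ Ioo (-1 : ℝ) 1 := fun x hx =>
    ⟨by linarith [hx.1, hr.2], by linarith [hx.2, hr.2]⟩
  have hseg : ∀ x ∈ Icc (-r) r, (x : ℂ) ∈ {z : ℂ | ‖z‖ ≤ r ∧ 0 ≤ z.im} := fun x hx => by
    simpa [abs_le] using hx
  have hgx : ContinuousOn (fun x : ℝ => g x) (Icc (-r) r) :=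
    (hc.mono hsub).comp Complex.continuous_ofReal.continuousOn hseg
  have hgarc : ContinuousOn (fun φ : ℝ => g (r * Complex.exp (φ * Complex.I))) (Icc 0 Real.pi) :=
    (hc.mono hsub).comp (Continuous.continuousOn (by fun_prop))
      fun _ => circle_mem_closedHalfDisc hr.1.le
  obtain ⟨B, hB⟩ := isCompact_Icc.exists_bound_of_continuousOn hgarc
  have hB0 : 0 ≤ B := (norm_nonneg _).trans (hB 0 ⟨le_rfl, Real.pi_pos.le⟩)
  set A : ℝ → ℝ → ℂ := fun ε φ => g (r * Complex.exp (φ * Complex.I)) *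
      (Complex.exp (cauchyTransform θ (r * Complex.exp (φ * Complex.I) + ε * Complex.I)) *
      ((r : ℂ) ^ 2 - (r * Complex.exp (φ * Complex.I)) ^ 2) ^ 2) *
        (r * Complex.exp (φ * Complex.I)) with hA
  have hbd : ∀ ε ∈ Icc (0 : ℝ) 1, ∀ φ ∈ Ioo 0 Real.pi, ‖A ε φ‖ ≤ B * 12 := by
    intro ε hε φ hφ
    have h1 := norm_exp_mul_cauchyTransform_mul_weight_le hm hb hs zero_le_one
      (by linarith) hr hε hφ
    rw [Complex.ofReal_one, one_mul] at h1
    rw [hA, norm_mul, norm_mul, norm_circle hr.1.le]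
    calc _ ≤ B * (12 * 1) * 1 := by
          gcongr
          · exact hr.1.le
          · exact hB φ (Ioo_subset_Icc_self hφ)
          · exact h1.trans (by gcongr; exact Real.sin_le_one φ)
          · exact hr.2.le
      _ = _ := by ring
  have hshift : ∀ ε : ℝ, DifferentiableOn ℂ
      (fun z => Complex.exp (cauchyTransform θ (z + ε * Complex.I))) {z | -ε < z.im} := by
    intro ε
    simpa using differentiableOn_exp_cauchyTransform_shift hm hi 1 (ε := ε)
  -- Cauchy's theorem for the shifted function; the factor `I` of `dz = I z dφ` turns imaginary
  -- parts on the diameter into real parts on the arc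
  have hcauchy : ∀ ε ∈ Ioc (0 : ℝ) 1, (∫ φ in (0 : ℝ)..Real.pi, A ε φ).re =
      -∫ x in (-r)..r, (g x * Complex.exp (cauchyTransform θ ((x : ℝ) + ε * Complex.I))).im *
        (r ^ 2 - x ^ 2) ^ 2 := by
    intro ε hε
    have hle : ∀ z : ℂ, 0 ≤ z.im → z ∈ {z : ℂ | -ε < z.im} := fun z hz => by
      simp only [mem_ofPred_eq]; linarith [hε.1]
    have hFc : ContinuousOn (fun z => g z * (Complex.exp (cauchyTransform θ (z + ε * Complex.I)) *
        ((r : ℂ) ^ 2 - z ^ 2) ^ 2)) {z | ‖z‖ ≤ r ∧ 0 ≤ z.im} :=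
      (hc.mono hsub).mul (((hshift ε).continuousOn.mono fun z hz => hle z hz.2).mul (by fun_prop))
    have h := integral_diameter_add_integral_arc_eq_zero hr.1 hFc
      ((hd.mono fun z hz => ⟨hz.1.trans hr.2, hz.2⟩).mul
        (((hshift ε).mono fun z hz => hle z hz.2.le).mul (by fun_prop)))
    have h2 : (∫ φ in (0 : ℝ)..Real.pi, g (r * Complex.exp (φ * Complex.I)) *
      (Complex.exp (cauchyTransform θ (r * Complex.exp (φ * Complex.I) + ε * Complex.I)) *
      ((r : ℂ) ^ 2 - (r * Complex.exp (φ * Complex.I)) ^ 2) ^ 2) *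
        (r * Complex.exp (φ * Complex.I) * Complex.I)) =
        (∫ φ in (0 : ℝ)..Real.pi, A ε φ) * Complex.I := by
      rw [← intervalIntegral.integral_mul_const]
      congr 1; ext φ; rw [hA]; ring
    have hFi : IntervalIntegrable (fun x : ℝ => g x * (Complex.exp (cauchyTransform θ
        ((x : ℂ) + ε * Complex.I)) * ((r : ℂ) ^ 2 - (x : ℂ) ^ 2) ^ 2))
        MeasureTheory.volume (-r) r := by
      apply ContinuousOn.intervalIntegrable
      rw [uIcc_of_le hrr]
      exact hFc.comp Complex.continuous_ofReal.continuousOn hseg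
    have h3 := Complex.imCLM.intervalIntegral_comp_comm hFi
    simp only [Complex.imCLM_apply] at h3
    rw [h2] at h
    have h4 := congrArg Complex.im h
    rw [Complex.add_im, ← h3, Complex.mul_I_im, Complex.zero_im] at h4
    rw [eq_neg_of_add_eq_zero_right h4]
    congr 2; ext x
    rw [← mul_assoc, show ((r : ℂ) ^ 2 - (x : ℂ) ^ 2) ^ 2 = (((r ^ 2 - x ^ 2) ^ 2 : ℝ) : ℂ) by
      push_cast; rfl, Complex.im_mul_ofReal]
  have hlim1 : Tendsto (fun ε => (∫ φ in (0 : ℝ)..Real.pi, A ε φ).re) (𝓝[>] 0) (𝓝 0) := by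
    have h1 := (tendsto_integral_im_mul_exp hm hb hs hα2 hr hgx
      (fun x hx => hreal x (hIcc hx)) (fun x hx => hcont x (hIcc hx))).neg
    rw [neg_zero] at h1
    refine h1.congr' ?_
    filter_upwards [Ioc_mem_nhdsGT one_pos] with ε hε
    exact (hcauchy ε hε).symm
  have hne : ∀ᵐ φ : ℝ, φ ≠ Real.pi := MeasureTheory.Measure.ae_ne MeasureTheory.volume Real.pi
  have hlim2 : Tendsto (fun ε => ∫ φ in (0 : ℝ)..Real.pi, A ε φ) (𝓝[>] 0)
      (𝓝 (∫ φ in (0 : ℝ)..Real.pi, A 0 φ)) := by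
    refine intervalIntegral.tendsto_integral_filter_of_dominated_convergence
      (fun _ => B * 12) ?_ ?_ intervalIntegrable_const ?_
    · filter_upwards [self_mem_nhdsWithin] with ε (hε : 0 < ε)
      rw [uIoc_of_le Real.pi_pos.le]
      refine ContinuousOn.aestronglyMeasurable ?_ measurableSet_Ioc
      refine ContinuousOn.mono ?_ Ioc_subset_Icc_self
      refine (hgarc.mul (ContinuousOn.mul ?_ (Continuous.continuousOn (by fun_prop)))).mul
        (Continuous.continuousOn (by fun_prop))
      exact (hshift ε).continuousOn.comp (f := fun φ : ℝ => (r : ℂ) * Complex.exp (φ * Complex.I))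
        (Continuous.continuousOn (by fun_prop)) fun φ hφ => by
          have := (circle_mem_closedHalfDisc hr.1.le hφ).2
          simp only [mem_ofPred_eq]; linarith
    · filter_upwards [Ioc_mem_nhdsGT one_pos] with ε hε
      filter_upwards [hne] with φ h1 h2
      rw [uIoc_of_le Real.pi_pos.le] at h2
      exact hbd ε ⟨hε.1.le, hε.2⟩ φ ⟨h2.1, lt_of_le_of_ne h2.2 h1⟩
    · filter_upwards [hne] with φ h1 h2
      rw [uIoc_of_le Real.pi_pos.le] at h2
      have him : 0 < ((r : ℂ) * Complex.exp (φ * Complex.I)).im := by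
        rw [circle_im]
        exact mul_pos hr.1 (Real.sin_pos_of_mem_Ioo ⟨h2.1, lt_of_le_of_ne h2.2 h1⟩)
      have hLc : ContinuousAt (cauchyTransform θ) (r * Complex.exp (φ * Complex.I)) :=
        ((differentiableOn_cauchyTransform hm hi).differentiableAt
          ((isOpen_lt continuous_const Complex.continuous_im).mem_nhds him)).continuousAt
      have hsh : Tendsto (fun ε : ℝ => (r : ℂ) * Complex.exp (φ * Complex.I) + ε * Complex.I)
          (𝓝[>] 0) (𝓝 (r * Complex.exp (φ * Complex.I))) := by
        have : Continuous fun ε : ℝ => (r : ℂ) * Complex.exp (φ * Complex.I) + ε * Complex.I := by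
          fun_prop
        simpa using (this.tendsto 0).mono_left nhdsWithin_le_nhds
      have h5 := (Complex.continuous_exp.tendsto _).comp (hLc.tendsto.comp hsh)
      have h6 := ((h5.mul_const (((r : ℂ) ^ 2 - (r * Complex.exp (φ * Complex.I)) ^ 2) ^ 2)).const_mul
        (g (r * Complex.exp (φ * Complex.I)))).mul_const ((r : ℂ) * Complex.exp (φ * Complex.I))
      simpa [hA] using h6
  have h7 := tendsto_nhds_unique hlim1 ((Complex.continuous_re.tendsto _).comp hlim2)
  refine Eq.trans ?_ h7.symm
  simp only [hA, Complex.ofReal_zero, zero_mul, add_zero, mul_assoc]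

/-! ### Vanishing to infinite order -/

theorem tendsto_add_mul_I_nhdsWithin {x : ℝ} (hx : x ∈ Ioo (-1 : ℝ) 1) :
    Tendsto (fun ε : ℝ => (x : ℂ) + ε * Complex.I) (𝓝[>] 0) (𝓝[upperHalfDisc] (x : ℂ)) := by
  have hcont : Continuous fun ε : ℝ => (x : ℂ) + ε * Complex.I := by fun_prop
  have hlim : Tendsto (fun ε : ℝ => (x : ℂ) + ε * Complex.I) (𝓝[>] 0) (𝓝 (x : ℂ)) := by
    simpa using (hcont.tendsto 0).mono_left nhdsWithin_le_nhds
  have hx1 : ‖(x : ℂ)‖ < 1 := by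
    rw [Complex.norm_real]; exact abs_lt.2 hx
  refine tendsto_nhdsWithin_iff.2 ⟨hlim, ?_⟩
  filter_upwards [hlim.norm.eventually_lt_const hx1, self_mem_nhdsWithin] with ε h1 h2
  exact ⟨h1, by simpa using h2⟩

/-- Vanishing to infinite order from inside the half disc passes to the diameter by continuity. -/
theorem exists_norm_le_pow {f : ℂ → ℂ} (hc : ContinuousOn f (upperHalfDisc ∪ openDiameter))
    (hvanish : VanishesToInfiniteOrder f upperHalfDisc 0) (N : ℕ) :
    ∃ δ > 0, ∀ z ∈ upperHalfDisc ∪ openDiameter, ‖z‖ < δ → ‖f z‖ ≤ ‖z‖ ^ N := by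
  have h := (hvanish N).norm
  rw [norm_zero] at h
  obtain ⟨δ, hδ, hball⟩ := Metric.mem_nhdsWithin_iff.1 (h.eventually_lt_const one_pos)
  have hin : ∀ z ∈ upperHalfDisc, ‖z‖ < δ → ‖f z‖ ≤ ‖z‖ ^ N := by
    intro z hz hzδ
    have h1 := hball ⟨by simpa using hzδ, hz⟩
    have hpos : 0 < ‖z‖ := norm_pos_iff.2 fun h0 => by simp [h0, upperHalfDisc] at hz
    simp only [mem_ofPred_eq, sub_zero, norm_div, Complex.norm_real, norm_pow, norm_norm] at h1
    rw [div_lt_one (by positivity)] at h1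
    exact h1.le
  refine ⟨δ, hδ, ?_⟩
  rintro z (hz | hz) hzδ
  · exact hin z hz hzδ
  · have hz' := hz
    obtain ⟨x, hx, rfl⟩ := hz
    have hlim := tendsto_add_mul_I_nhdsWithin hx
    have hnorm := (hlim.mono_right nhdsWithin_le_nhds).norm
    refine le_of_tendsto_of_tendsto
      (((hc _ (Or.inr hz')).mono subset_union_left).tendsto.comp hlim).norm
      (hnorm.pow N) ?_
    filter_upwards [hlim.eventually self_mem_nhdsWithin, hnorm.eventually_lt_const hzδ] with ε h1 h2
    exact hin _ h1 h2

/-- At the origin the value of the product is `0`, whatever the convention for `0 ^ m`, since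
`f 0 = 0`. -/
theorem continuousOn_mul_zpow {f : ℂ → ℂ} (hc : ContinuousOn f (upperHalfDisc ∪ openDiameter))
    (hvanish : VanishesToInfiniteOrder f upperHalfDisc 0) (m : ℤ) :
    ContinuousOn (fun z => f z * z ^ m) (upperHalfDisc ∪ openDiameter) := by
  intro z hz
  rcases eq_or_ne z 0 with rfl | h0
  · obtain ⟨δ, hδ, hle⟩ := exists_norm_le_pow hc hvanish (m.natAbs + 1)
    have hf0 : f 0 = 0 := by
      have := hle 0 hz (by simpa using hδ)
      simpa using this
    rw [ContinuousWithinAt, hf0, zero_mul]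
    refine squeeze_zero_norm' (a := fun z => ‖z‖) ?_
      (by simpa using (continuous_norm.tendsto (0 : ℂ)).mono_left nhdsWithin_le_nhds)
    filter_upwards [self_mem_nhdsWithin, nhdsWithin_le_nhds (Metric.ball_mem_nhds (0 : ℂ)
      (lt_min hδ one_pos))] with z hz hzb
    rw [mem_ball_zero_iff, lt_min_iff] at hzb
    rcases eq_or_ne z 0 with rfl | h0
    · simp [hf0]
    · have hpos : 0 < ‖z‖ := norm_pos_iff.2 h0
      rw [norm_mul, norm_zpow]
      calc ‖f z‖ * ‖z‖ ^ m ≤ ‖z‖ ^ (m.natAbs + 1) * ‖z‖ ^ m := by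
            gcongr
            exact hle z hz hzb.1
        _ = ‖z‖ ^ (((m.natAbs + 1 : ℕ) : ℤ) + m) := by rw [zpow_add₀ hpos.ne', zpow_natCast]
        _ ≤ ‖z‖ ^ (1 : ℤ) := zpow_le_zpow_right_of_le_one₀ hpos hzb.2.le (by omega)
        _ = ‖z‖ := zpow_one _
  · exact (hc z hz).mul (continuousAt_zpow₀ z m (Or.inl h0)).continuousWithinAt

/-! ### Unique continuation -/

/-- Applied to `f(z) z^m` for all integers `m`, which is possible because `f` vanishes to infinite
order at `0`, the integral identity on the arc says that the product of `f`,
`exp (cauchyTransform θ)` and the weight has purely imaginary moments of all orders on the half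
circle of radius `r`; hence this product vanishes there, and so does `f`. -/
theorem eq_zero_on_arc {θ : ℝ → ℝ} {α r : ℝ} (hm : Measurable θ) (hb : ∀ t, |θ t| ≤ α)
    (hs : ∀ t ∉ Ioo (-1 : ℝ) 1, θ t = 0) (hα2 : α < Real.pi / 2) (hr : r ∈ Ioo 0 1)
    {f : ℂ → ℂ} (hd : DifferentiableOn ℂ f upperHalfDisc)
    (hc : ContinuousOn f (upperHalfDisc ∪ openDiameter))
    (hvanish : VanishesToInfiniteOrder f upperHalfDisc 0)
    (hreal : ∀ x ∈ Ioo (-1 : ℝ) 1, (f x * Complex.exp (-θ x * Complex.I)).im = 0)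
    (hcont : ∀ x ∈ Ioo (-1 : ℝ) 1, f x = 0 ∨ ContinuousAt θ x) :
    ∀ φ ∈ Ioo 0 Real.pi, f (r * Complex.exp (φ * Complex.I)) = 0 := by
  have hi := integrable_of_bounded_of_support hm hb hs
  have hgarc : ContinuousOn (fun φ : ℝ => f (r * Complex.exp (φ * Complex.I))) (Icc 0 Real.pi) :=
    (hc.mono (closedHalfDisc_subset hr.2)).comp (Continuous.continuousOn (by fun_prop))
      fun _ => circle_mem_closedHalfDisc hr.1.le
  obtain ⟨B, hB⟩ := isCompact_Icc.exists_bound_of_continuousOn hgarc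
  have hB0 : 0 ≤ B := (norm_nonneg _).trans (hB 0 ⟨le_rfl, Real.pi_pos.le⟩)
  set b : ℝ → ℂ := fun φ => f (r * Complex.exp (φ * Complex.I)) *
    (Complex.exp (cauchyTransform θ (r * Complex.exp (φ * Complex.I))) *
      ((r : ℂ) ^ 2 - (r * Complex.exp (φ * Complex.I)) ^ 2) ^ 2) with hbdef
  set a : ℝ → ℂ := (Ioo 0 Real.pi).indicator b with hadef
  have hbound : ∀ φ, ‖a φ‖ ≤ B * (12 * max 0 (min φ (Real.pi - φ))) := by
    intro φ
    by_cases hφ : φ ∈ Ioo 0 Real.pi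
    · have h1 := norm_exp_mul_cauchyTransform_mul_weight_le hm hb hs zero_le_one
        (by linarith) hr (ε := 0) ⟨le_rfl, zero_le_one⟩ hφ
      rw [Complex.ofReal_one, one_mul, Complex.ofReal_zero, zero_mul, add_zero] at h1
      rw [hadef, indicator_of_mem hφ, hbdef, norm_mul]
      gcongr
      · exact hB φ (Ioo_subset_Icc_self hφ)
      · refine h1.trans ?_
        gcongr
        refine le_max_of_le_right (le_min (Real.sin_le hφ.1.le) ?_)
        rw [← Real.sin_pi_sub]
        exact Real.sin_le (by linarith [hφ.2])
    · rw [hadef, indicator_of_notMem hφ, norm_zero]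
      positivity
  have hacont : Continuous a := by
    rw [continuous_iff_continuousAt]
    intro φ
    by_cases hφ : φ ∈ Ioo 0 Real.pi
    · have hnhds : Ioo 0 Real.pi ∈ 𝓝 φ := isOpen_Ioo.mem_nhds hφ
      have hbc : ContinuousAt b φ := by
        have h1 := hgarc.continuousAt (mem_of_superset hnhds Ioo_subset_Icc_self)
        have him : 0 < ((r : ℂ) * Complex.exp (φ * Complex.I)).im := by
          rw [circle_im]
          exact mul_pos hr.1 (Real.sin_pos_of_mem_Ioo hφ)
        have hLc : ContinuousAt (cauchyTransform θ) (r * Complex.exp (φ * Complex.I)) :=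
          ((differentiableOn_cauchyTransform hm hi).differentiableAt
            ((isOpen_lt continuous_const Complex.continuous_im).mem_nhds him)).continuousAt
        have h2 : ContinuousAt (fun φ : ℝ =>
            cauchyTransform θ (r * Complex.exp (φ * Complex.I))) φ :=
          ContinuousAt.comp (f := fun φ : ℝ => (r : ℂ) * Complex.exp (φ * Complex.I)) hLc
            (Continuous.continuousAt (by fun_prop))
        exact h1.mul (h2.cexp.mul (Continuous.continuousAt (by fun_prop)))
      refine hbc.congr (mem_of_superset hnhds fun ψ hψ => ?_)
      exact (indicator_of_mem hψ b).symm
    · have h0 : a φ = 0 := indicator_of_notMem hφ b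
      have hmax : max 0 (min φ (Real.pi - φ)) = 0 := by
        refine max_eq_left ?_
        by_contra! h
        exact hφ ⟨(lt_min_iff.1 h).1, by linarith [(lt_min_iff.1 h).2]⟩
      rw [ContinuousAt, h0]
      refine squeeze_zero_norm hbound ?_
      have : Continuous fun φ : ℝ => B * (12 * max 0 (min φ (Real.pi - φ))) := by fun_prop
      simpa [hmax] using this.tendsto φ
  have hmom : ∀ n : ℤ, (∫ φ in (0 : ℝ)..Real.pi, a φ * Complex.exp (n * φ * Complex.I)).re = 0 := by
    intro n
    have hz0 : ∀ x : ℝ, ∀ w : ℂ, ((x : ℂ) ^ (n - 1)) * w = ((x ^ (n - 1) : ℝ) : ℂ) * w := by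
      intro x w; push_cast; rfl
    have h := re_integral_arc_eq_zero hm hb hs hα2 hr (g := fun z => f z * z ^ (n - 1))
      (hd.mul fun z hz => (differentiableAt_zpow.2 (Or.inl fun h0 => by
        simp [h0, upperHalfDisc] at hz)).differentiableWithinAt)
      (continuousOn_mul_zpow hc hvanish (n - 1))
      (fun x hx => by
        rw [mul_right_comm, mul_comm, hz0, Complex.im_ofReal_mul, hreal x hx, mul_zero])
      (fun x hx => (hcont x hx).imp_left fun h0 => by simp [h0])
    have hr0 : (r : ℂ) ≠ 0 := by exact_mod_cast hr.1.ne'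
    have hint : (∫ φ in (0 : ℝ)..Real.pi, f (r * Complex.exp (φ * Complex.I)) *
        (r * Complex.exp (φ * Complex.I)) ^ (n - 1) *
        Complex.exp (cauchyTransform θ (r * Complex.exp (φ * Complex.I))) *
        ((r : ℂ) ^ 2 - (r * Complex.exp (φ * Complex.I)) ^ 2) ^ 2 *
        (r * Complex.exp (φ * Complex.I))) =
        ((r ^ n : ℝ) : ℂ) * ∫ φ in (0 : ℝ)..Real.pi, a φ * Complex.exp (n * φ * Complex.I) := by
      rw [← intervalIntegral.integral_const_mul]
      refine intervalIntegral.integral_congr_Ioo_of_le Real.pi_pos.le fun φ hφ => ?_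
      have hne : (r : ℂ) * Complex.exp (φ * Complex.I) ≠ 0 := mul_ne_zero hr0 (Complex.exp_ne_zero _)
      have hpow : (r * Complex.exp (φ * Complex.I)) ^ (n - 1) * (r * Complex.exp (φ * Complex.I)) =
          (r : ℂ) ^ n * Complex.exp (n * φ * Complex.I) := by
        rw [← zpow_add_one₀ hne, sub_add_cancel, mul_zpow, ← Complex.exp_int_mul, mul_assoc (n : ℂ)]
      rw [hadef, indicator_of_mem hφ, hbdef]
      push_cast
      linear_combination (f (r * Complex.exp (φ * Complex.I)) *
        (Complex.exp (cauchyTransform θ (r * Complex.exp (φ * Complex.I))) *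
        ((r : ℂ) ^ 2 - (r * Complex.exp (φ * Complex.I)) ^ 2) ^ 2)) * hpow
    rw [hint, Complex.re_ofReal_mul] at h
    exact (mul_eq_zero.1 h).resolve_left (zpow_ne_zero _ hr.1.ne')
  intro φ hφ
  have h0 := eq_zero_of_re_integral_mul_exp_eq_zero hacont
    (fun φ hφ => indicator_of_notMem hφ b) hmom φ
  rw [hadef, indicator_of_mem hφ, hbdef] at h0
  refine (mul_eq_zero.1 h0).resolve_right (mul_ne_zero (Complex.exp_ne_zero _) ?_)
  rw [sq_sub_sq_circle]
  refine mul_ne_zero ?_ (pow_ne_zero _ (Complex.exp_ne_zero _))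
  have h1 := (Real.sin_pos_of_mem_Ioo hφ).ne'
  have h2 := hr.1.ne'
  exact_mod_cast mul_ne_zero (mul_ne_zero (by norm_num) (pow_ne_zero _ h2)) (pow_ne_zero _ h1)

/-- `f` is the function on `Δ⁺` together with its smooth extension to `Δ⁺ ∪ (-1, 1)`;
its values elsewhere play no role. -/
theorem mainTheorem2 (C : ℝ) (hC : 0 < C) (f : ℂ → ℂ)
    (hol : DifferentiableOn ℂ f upperHalfDisc)
    (hsmooth : ContDiffOn ℝ ∞ f (upperHalfDisc ∪ openDiameter))
    (hcone : MapsTo f openDiameter (coneGamma C))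
    (hzeros : ∀ x ∈ openDiameter, AccPt x (𝓟 (diameterZeros f)) → x = 0)
    (hvanish : VanishesToInfiniteOrder f upperHalfDisc 0) :
    EqOn f 0 (upperHalfDisc ∪ openDiameter) := by
  have hc := hsmooth.continuousOn
  set u : ℝ → ℂ := (Ioo (-1 : ℝ) 1).indicator fun x => f x with hu
  -- where `Re u = 0` the cone condition gives `u = 0`, and there `θ` has the junk value
  -- `arctan (0 / 0) = 0`, which does no harm
  set θ : ℝ → ℝ := fun x => Real.arctan ((u x).im / (u x).re) with hθ
  have hfx : ContinuousOn (fun x : ℝ => f x) (Ioo (-1) 1) :=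
    hc.comp Complex.continuous_ofReal.continuousOn fun x hx => Or.inr ⟨x, hx, rfl⟩
  have hum : Measurable u := by
    classical
    rw [hu, ← piecewise_eq_indicator]
    exact hfx.measurable_piecewise continuousOn_const measurableSet_Ioo
  have hcone' : ∀ x ∈ Ioo (-1 : ℝ) 1, f x ∈ coneGamma C := fun x hx => hcone ⟨x, hx, rfl⟩
  have hux : ∀ x ∈ Ioo (-1 : ℝ) 1, u x = f x := fun x hx => indicator_of_mem hx _
  have hm : Measurable θ := Real.measurable_arctan.comp
    ((Complex.measurable_im.comp hum).div (Complex.measurable_re.comp hum))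
  have hs : ∀ t ∉ Ioo (-1 : ℝ) 1, θ t = 0 := fun t ht => by
    simp [hθ, hu, indicator_of_notMem ht]
  have hb : ∀ t, |θ t| ≤ Real.arctan C := by
    intro t
    by_cases ht : t ∈ Ioo (-1 : ℝ) 1
    · simp only [hθ, hux t ht]
      exact abs_arctan_im_div_re_le hC.le (hcone' t ht)
    · rw [hs t ht, abs_zero, Real.arctan_nonneg]
      exact hC.le
  have hre0 : ∀ x ∈ Ioo (-1 : ℝ) 1, (f x).re = 0 → (f x).im = 0 := by
    intro x hx h0
    have h1 : |(f x).im| ≤ C * |(f x).re| := hcone' x hx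
    rw [h0, abs_zero, mul_zero] at h1
    exact abs_nonpos_iff.1 h1
  have hreal : ∀ x ∈ Ioo (-1 : ℝ) 1, (f x * Complex.exp (-θ x * Complex.I)).im = 0 := by
    intro x hx
    simp only [hθ, hux x hx]
    exact im_mul_exp_neg_arctan_eq_zero (hre0 x hx)
  -- off the zeros of `f` the cone condition forces `Re f ≠ 0`, so the slope `Im f / Re f` is
  -- continuous there
  have hcont : ∀ x ∈ Ioo (-1 : ℝ) 1, f x = 0 ∨ ContinuousAt θ x := by
    intro x hx
    by_cases h0 : f x = 0
    · exact Or.inl h0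
    · right
      have hnhds : Ioo (-1 : ℝ) 1 ∈ 𝓝 x := isOpen_Ioo.mem_nhds hx
      have huc : ContinuousAt u x := (hfx.continuousAt hnhds).congr
        (mem_of_superset hnhds fun y hy => (hux y hy).symm)
      have hre : (u x).re ≠ 0 := by
        rw [hux x hx]
        exact fun h => h0 (Complex.ext h (hre0 x hx h))
      exact Real.continuous_arctan.continuousAt.comp
        ((Complex.continuous_im.continuousAt.comp huc).div
          (Complex.continuous_re.continuousAt.comp huc) hre)
  -- the half disc is swept out by the arcs `|z| = r`, `0 < r < 1`
  have hin : ∀ z ∈ upperHalfDisc, f z = 0 := by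
    intro z hz
    have hz0 : z ≠ 0 := fun h0 => by simp [h0, upperHalfDisc] at hz
    have hr : ‖z‖ ∈ Ioo (0 : ℝ) 1 := ⟨norm_pos_iff.2 hz0, hz.1⟩
    have harg : Complex.arg z ∈ Ioo 0 Real.pi := by
      refine ⟨lt_of_le_of_ne (Complex.arg_nonneg_iff.2 hz.2.le) fun h => ?_,
        Complex.arg_lt_pi_iff.2 (Or.inr hz.2.ne')⟩
      exact hz.2.ne' (Complex.arg_eq_zero_iff.1 h.symm).2
    have := eq_zero_on_arc hm hb hs (Real.arctan_lt_pi_div_two C) hr hol hc hvanish hreal hcont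
      _ harg
    rwa [Complex.norm_mul_exp_arg_mul_I] at this
  rintro z (hz | hz)
  · exact hin z hz
  · have hz' := hz
    obtain ⟨x, hx, rfl⟩ := hz
    have hlim := tendsto_add_mul_I_nhdsWithin hx
    refine tendsto_nhds_unique
      (((hc _ (Or.inr hz')).mono subset_union_left).tendsto.comp hlim) ?_
    refine tendsto_const_nhds.congr' ?_
    filter_upwards [hlim.eventually self_mem_nhdsWithin] with ε hε
    exact (hin _ hε).symm
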